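/- Let $\mathbb{H}(\mathbb{C})$ be the algebra of quaternions over $\mathbb{C}$ with basis $1,I,J,K$, where $I^2=J^2=K^2=-1$, $IJ=-JI=K$, $JK=-KJ=I$, $KI=-IK=J$, and let $$e_1=\tfrac12(1+iI),\quad e_2=\tfrac12(1-iI),\quad e_3=\tfrac12(iJ-K),\quad e_4=\tfrac12(iJ+K),$$ a basis of $\mathbb{H}(\mathbb{C})$ over $\mathbb{C}$; put $\|\sum_{k=1}^4 a_ke_k\|=\big(\sum_{k=1}^4|a_k|^2\big)^{1/2}$. Let $f_1,f_2:\mathbb{H}(\mathbb{C})\to\mathbb{C}$ be the $\mathbb{C}$-linear functionals with $f_1(e_1)=f_1(e_3)=1$, $f_1(e_2)=f_1(e_4)=0$ and $f_2(e_2)=f_2(e_4)=1$, $f_2(e_1)=f_2(e_3)=0$. Let $a_1,a_2,b_1,b_2\in\mathbb{C}$ be such that $i_1=1$, $i_2=a_1e_1+a_2e_2$, $i_3=b_1e_1+b_2e_2$ are linearly independent over $\mathbb{R}$, let $E_3=\{xi_1+yi_2+zi_3: x,y,z\in\mathbb{R}\}$, and assume $f_1(E_3)=f_2(E_3)=\mathbb{C}$.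 For $k=1,2$ let $L_k$ be the line in $\mathbb{R}^3$ given by $x+y\operatorname{Re}a_k+z\operatorname{Re}b_k=0$, $\;y\operatorname{Im}a_k+z\operatorname{Im}b_k=0$. Let $\Omega\subset\mathbb{R}^3$ be a domain (a non-empty connected open set) that is convex in the directions of $L_1$ and $L_2$, that is, for $k=1,2$, $\Omega$ contains every segment that is parallel to $L_k$ and joins two points of $\Omega$. Put $\Omega_\zeta=\{xi_1+yi_2+zi_3:(x,y,z)\in\Omega\}$ and $D_k=f_k(\Omega_\zeta)\subset\mathbb{C}$, $k=1,2$. Let $\Phi:\Omega_\zeta\to\mathbb{H}(\mathbb{C})$ be right-$G$-monogenic, that is, $\Phi$ is continuous and for every $\zeta\in\Omega_\zeta$ there is an element $\Phi'(\zeta)\in\mathbb{H}(\mathbb{C})$ such that $$\lim_{\varepsilon\to0+}\big(\Phi(\zeta+\varepsilon h)-\Phi(\zeta)\big)\varepsilon^{-1}=h\,\Phi'(\zeta)\qquad\text{for all } h\in E_3 .$$ Then there are functions $F_1,F_3$ analytic on $D_1$ and $F_2,F_4$ analytic on $D_2$ such that, for all $\zeta=xi_1+yi_2+zi_3\in\Omega_\zeta$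 with $(x,y,z)\in\Omega$, $$\Phi(\zeta)=F_1(\xi_1)e_1+F_2(\xi_2)e_2+F_3(\xi_1)e_3+F_4(\xi_2)e_4,\qquad \xi_k=x+ya_k+zb_k .$$ -/

import Mathlib

open Filter Topology

namespace GMonogenic

/-- The algebra of quaternions over the field of complex numbers, with basis `1, I, J, K` and
`I² = J² = K² = -1`, `IJ = -JI = K`, `JK = -KJ = I`, `KI = -IK = J`. -/
abbrev HC : Type := QuaternionAlgebra ℂ (-1) 0 (-1)

/-- `e₁ = (1 + iI) / 2`. -/
noncomputable def e₁ : HC := ⟨1 / 2, Complex.I / 2, 0, 0⟩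

/-- `e₂ = (1 - iI) / 2`. -/
noncomputable def e₂ : HC := ⟨1 / 2, -Complex.I / 2, 0, 0⟩

/-- `e₃ = (iJ - K) / 2`. -/
noncomputable def e₃ : HC := ⟨0, 0, Complex.I / 2, -1 / 2⟩

/-- `e₄ = (iJ + K) / 2`. -/
noncomputable def e₄ : HC := ⟨0, 0, Complex.I / 2, 1 / 2⟩

/-- The coordinates of a complex quaternion with respect to `e₁, e₂, e₃, e₄`. -/
noncomputable def coordEquiv : HC ≃ₗ[ℂ] (Fin 4 → ℂ) where
  toFun q := ![q.re - Complex.I * q.imI, q.re + Complex.I * q.imI,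
    -Complex.I * q.imJ - q.imK, -Complex.I * q.imJ + q.imK]
  map_add' p q := by
    ext k; fin_cases k <;> simp <;> ring
  map_smul' c q := by
    ext k; fin_cases k <;> simp <;> ring
  invFun v := v 0 • e₁ + v 1 • e₂ + v 2 • e₃ + v 3 • e₄
  left_inv q := by
    ext <;> simp [e₁, e₂, e₃, e₄] <;> ring_nf <;> simp
  right_inv v := by
    ext k; fin_cases k <;> simp [e₁, e₂, e₃, e₄] <;> ring_nf <;> simp <;> ring

/-- The basis `e₁, e₂, e₃, e₄` of the algebra of complex quaternions. -/
noncomputable def basisE : Module.Basis (Fin 4) ℂ HC := Module.Basis.ofEquivFun coordEquiv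

theorem basisE_eq : ⇑basisE = ![e₁, e₂, e₃, e₄] := by
  ext1 k
  rw [basisE, Module.Basis.coe_ofEquivFun]
  fin_cases k <;> simp [coordEquiv]

/-- The norm `‖a‖ = (|a₁|² + |a₂|² + |a₃|² + |a₄|²)^(1/2)` of `a = ∑ aₖ eₖ`, obtained by
identifying `a` with the vector of its coordinates in the Euclidean space `ℂ⁴`. -/
noncomputable instance : NormedAddCommGroup HC :=
  NormedAddCommGroup.induced HC (EuclideanSpace ℂ (Fin 4))
    (basisE.equivFun.trans (WithLp.linearEquiv 2 ℂ (Fin 4 → ℂ)).symm)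
    (LinearEquiv.injective _)

theorem norm_eq (q : HC) : ‖q‖ = √(∑ k, ‖basisE.repr q k‖ ^ 2) :=
  EuclideanSpace.norm_eq
    ((basisE.equivFun.trans (WithLp.linearEquiv 2 ℂ (Fin 4 → ℂ)).symm) q)

/-- The linear functional with `f₁ e₁ = f₁ e₃ = 1` and `f₁ e₂ = f₁ e₄ = 0`. -/
noncomputable def f₁ : HC →ₗ[ℂ] ℂ := basisE.constr ℂ ![1, 0, 1, 0]

/-- The linear functional with `f₂ e₂ = f₂ e₄ = 1` and `f₂ e₁ = f₂ e₃ = 0`. -/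
noncomputable def f₂ : HC →ₗ[ℂ] ℂ := basisE.constr ℂ ![0, 1, 0, 1]

/-- The vector `c₁ e₁ + c₂ e₂`; the vectors `i₂`, `i₃` have this form. -/
noncomputable def vec (c₁ c₂ : ℂ) : HC := c₁ • e₁ + c₂ • e₂

/-- The real linear span `E₃` of three vectors `1, i₂, i₃`. -/
noncomputable def E3 (i₂ i₃ : HC) : Submodule ℝ HC := Submodule.span ℝ {1, i₂, i₃}

/-- The point `ζ = x + y i₂ + z i₃` that corresponds to `(x, y, z)`. -/
noncomputable def zeta (i₂ i₃ : HC) (p : EuclideanSpace ℝ (Fin 3)) : HC :=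
  p 0 • (1 : HC) + p 1 • i₂ + p 2 • i₃

/-- The set `Ω_ζ = {x + y i₂ + z i₃ : (x, y, z) ∈ Ω}`. -/
noncomputable def domZeta (i₂ i₃ : HC) (Ω : Set (EuclideanSpace ℝ (Fin 3))) : Set HC :=
  zeta i₂ i₃ '' Ω

/-- The complex variable `ξ = x + y a + z b`. -/
noncomputable def xi (a b : ℂ) (p : EuclideanSpace ℝ (Fin 3)) : ℂ :=
  (p 0 : ℂ) + (p 1 : ℂ) * a + (p 2 : ℂ) * b

/-- The set of all `(x, y, z)` with `x + y Re a + z Re b = 0` and `y Im a + z Im b = 0`; it is a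
line through the origin as soon as `a` or `b` is not real. -/
def line (a b : ℂ) : Submodule ℝ (EuclideanSpace ℝ (Fin 3)) where
  carrier := {p | p 0 + p 1 * a.re + p 2 * b.re = 0 ∧ p 1 * a.im + p 2 * b.im = 0}
  zero_mem' := by simp
  add_mem' := by
    rintro p q ⟨h1, h2⟩ ⟨h3, h4⟩
    simp only [Set.mem_ofPred_eq, PiLp.add_apply]
    exact ⟨by linear_combination h1 + h3, by linear_combination h2 + h4⟩
  smul_mem' := by
    rintro c p ⟨h1, h2⟩
    simp only [Set.mem_ofPred_eq, PiLp.smul_apply, smul_eq_mul]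
    exact ⟨by linear_combination c * h1, by linear_combination c * h2⟩

/-- `Ω` is convex in the direction of the line `L` through the origin: it contains every segment
that is parallel to `L` and joins two points of `Ω`. -/
def ConvexInDirection (L : Submodule ℝ (EuclideanSpace ℝ (Fin 3)))
    (Ω : Set (EuclideanSpace ℝ (Fin 3))) : Prop :=
  ∀ p ∈ Ω, ∀ q ∈ Ω, q - p ∈ L → segment ℝ p q ⊆ Ω

/-- `Φ` is right-`G`-monogenic in `S ⊆ E`: it is continuous on `S`, and at every point `ζ` of `S`
there is an element `Φ'` of the algebra (the right Gateaux derivative) such that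
`(Φ (ζ + ε h) - Φ ζ) / ε` tends to `h * Φ'` as `ε → 0+`, for all `h` in `E`. -/
def IsRightGMonogenic (E : Submodule ℝ HC) (S : Set HC) (Φ : HC → HC) : Prop :=
  ContinuousOn Φ S ∧
    ∀ ζ ∈ S, ∃ Φ' : HC, ∀ h ∈ E,
      Tendsto (fun ε : ℝ => ε⁻¹ • (Φ (ζ + ε • h) - Φ ζ)) (𝓝[>] 0) (𝓝 (h * Φ'))

end GMonogenic

open GMonogenic

/-! Left multiplication by `ζ` is diagonal in `e₁, e₂, e₃, e₄`, with entries `ξ₁, ξ₂, ξ₁, ξ₂`. Hence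
each coordinate of `Φ` has directional derivatives `ξ(v) * c`. They vanish along `ker ξ`, so
directional convexity makes the coordinate a function `F` of `ξ`. This `F` is continuous with a
complex-linear Gateaux derivative at every point.

The hard part is that such an `F` is holomorphic although the derivative is not assumed continuous
or bounded (`differentiableOn_of_gateaux`). If the slope is bounded, Fubini's theorem and Morera's
theorem suffice. In general, Baire's theorem finds a portion of the exceptional closed set on which
difference quotients are uniformly bounded in a disc of directions. This gives a Lipschitz bound on
that portion, a Phragmén-Lindelöf argument carries it to nearby points, and Cauchy's estimate then
bounds the slope, so that the portion was not exceptional. -/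

namespace GMonogenic

open Set Metric MeasureTheory
open scoped Interval

/-! ### Complex-linear Gateaux derivatives and the case of bounded slope -/

/-- `f` has a complex-linear Gateaux derivative at `z` with slope `c`: its derivative at `z` in
every direction `u` is `u * c`. -/
def HasGateauxSlopeAt (f : ℂ → ℂ) (c z : ℂ) : Prop :=
  ∀ u : ℂ, HasDerivAt (fun t : ℝ => f (z + t * u)) (u * c) 0

theorem HasGateauxSlopeAt.congr {f g : ℂ → ℂ} {c z : ℂ} (h : HasGateauxSlopeAt f c z)
    (hfg : g =ᶠ[𝓝 z] f) : HasGateauxSlopeAt g c z := by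
  intro u
  refine (h u).congr_of_eventuallyEq ?_
  have : Tendsto (fun t : ℝ => z + t * u) (𝓝 0) (𝓝 z) := by
    have : Continuous (fun t : ℝ => z + t * u) := by fun_prop
    simpa using this.tendsto 0
  exact this.eventually hfg

theorem HasGateauxSlopeAt.eq_deriv {f : ℂ → ℂ} {c z : ℂ} (h : HasGateauxSlopeAt f c z)
    (hd : DifferentiableAt ℂ f z) : c = deriv f z := by
  have h1 : HasDerivAt (fun t : ℝ => f (z + t * 1)) (deriv f z) 0 := by
    have h2 : HasDerivAt (fun w : ℂ => f (z + w * 1)) (deriv f z) ((0 : ℝ) : ℂ) := by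
      have h3 : HasDerivAt (fun w : ℂ => z + w * 1) 1 ((0 : ℝ) : ℂ) := by
        simpa using (hasDerivAt_id (0 : ℂ)).const_add z
      have h4 : HasDerivAt f (deriv f z) (z + ((0 : ℝ) : ℂ) * 1) := by
        simpa using hd.hasDerivAt
      simpa using! h4.comp ((0 : ℝ) : ℂ) h3
    exact h2.comp_ofReal
  simpa using (h 1).unique h1

theorem HasGateauxSlopeAt.hasDerivAt_comp_line {f : ℂ → ℂ} {c w u : ℂ} {t : ℝ}
    (h : HasGateauxSlopeAt f c (w + t * u)) :
    HasDerivAt (fun s : ℝ => f (w + s * u)) (u * c) t := by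
  have h1 : HasDerivAt (fun s : ℝ => s - t) 1 t := (hasDerivAt_id t).sub_const t
  have h3 := HasDerivAt.scomp_of_eq t (h u) h1 (sub_self t).symm
  simp only [one_smul] at h3
  refine h3.congr_of_eventuallyEq (Eventually.of_forall fun s => ?_)
  simp only [Function.comp_apply]
  congr 1
  push_cast
  ring

/-- The slope is a pointwise limit of continuous difference quotients in direction `1` with steps `1
/ (n + 1)`. Fubini's theorem needs this measurability. -/
theorem measurable_indicator_of_hasGateauxSlopeAt {f c : ℂ → ℂ} (hf : Continuous f) {U : Set ℂ}
    (hU : IsOpen U) (h : ∀ z ∈ U, HasGateauxSlopeAt f (c z) z) : Measurable (U.indicator c) := by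
  let q : ℕ → ℂ → ℂ := fun n z => ((n : ℝ) + 1) • (f (z + ((((n : ℝ) + 1)⁻¹ : ℝ) : ℂ) * 1) - f z)
  refine measurable_of_tendsto_metrizable (f := fun n => U.indicator (q n)) (fun n => ?_) ?_
  · refine Measurable.indicator (Continuous.measurable ?_) hU.measurableSet
    fun_prop
  · rw [tendsto_pi_nhds]
    intro z
    by_cases hz : z ∈ U
    · simp only [indicator_of_mem hz]
      have h1 := (h z hz 1).tendsto_slope_zero
      have h2 : Tendsto (fun n : ℕ => (((n : ℝ) + 1)⁻¹ : ℝ)) atTop (𝓝[≠] 0) := by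
        rw [tendsto_nhdsWithin_iff]
        refine ⟨by simpa using tendsto_one_div_add_atTop_nhds_zero_nat (𝕜 := ℝ), ?_⟩
        exact Eventually.of_forall fun n => by simp only [mem_compl_iff, mem_singleton_iff]; positivity
      have h3 := h1.comp h2
      simp only [one_mul] at h3
      refine h3.congr fun n => ?_
      simp [q]
    · simp [indicator_of_notMem hz]

/-- A continuous function with a bounded complex-linear Gateaux derivative is holomorphic. -/
theorem differentiableOn_of_bounded_gateaux {f c : ℂ → ℂ} (hf : Continuous f) {U : Set ℂ}
    (hU : IsOpen U) (h : ∀ z ∈ U, HasGateauxSlopeAt f (c z) z) {C : ℝ}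
    (hC : ∀ z ∈ U, ‖c z‖ ≤ C) : DifferentiableOn ℂ f U := by
  rw [← Complex.isConservativeOn_and_continuousOn_iff_isDifferentiableOn hU]
  refine ⟨fun z w hzw => ?_, hf.continuousOn⟩
  set g := U.indicator c with hg
  have hgm : Measurable g := measurable_indicator_of_hasGateauxSlopeAt hf hU h
  have hgb : ∀ z, ‖g z‖ ≤ max C 0 := by
    intro z
    by_cases hz : z ∈ U
    · simp [hg, indicator_of_mem hz, hC z hz]
    · simp [hg, indicator_of_notMem hz]
  have hslope : ∀ x ∈ [[z.re, w.re]], ∀ y ∈ [[z.im, w.im]],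
      HasGateauxSlopeAt f (g (x + y * Complex.I)) (x + y * Complex.I) := by
    intro x hx y hy
    have hm : (x + y * Complex.I : ℂ) ∈ U := hzw (by
      simp only [Complex.Rectangle, Complex.mem_reProdIm]; simpa using ⟨hx, hy⟩)
    rw [hg, indicator_of_mem hm]
    exact h _ hm
  have hint : ∀ {φ : ℝ → ℂ} (_ : Measurable φ) (u : ℂ) (a b : ℝ),
      IntervalIntegrable (fun t => u * g (φ t)) volume a b := by
    intro φ hφ u a b
    rw [intervalIntegrable_iff]
    refine Measure.integrableOn_of_bounded (M := ‖u‖ * max C 0) (by simp)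
      ((hgm.comp hφ).const_mul u).aestronglyMeasurable (Eventually.of_forall fun t => ?_)
    rw [norm_mul]
    exact mul_le_mul_of_nonneg_left (hgb _) (norm_nonneg _)
  -- The derivative exists everywhere on the segment and is bounded and measurable, so the
  -- fundamental theorem of calculus needs no continuity of `g`.
  have hV : ∀ x ∈ [[z.re, w.re]], f (x + w.im * Complex.I) - f (x + z.im * Complex.I) =
      ∫ y in z.im..w.im, Complex.I * g (x + y * Complex.I) := by
    intro x hx
    rw [intervalIntegral.integral_eq_sub_of_hasDerivAt
      (f := fun y : ℝ => f (x + y * Complex.I))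
      (fun y hy => (hslope x hx y hy).hasDerivAt_comp_line) (hint (φ := fun y : ℝ => x + y * Complex.I) (by fun_prop) _ _ _)]
  have hH : ∀ y ∈ [[z.im, w.im]], f (w.re + y * Complex.I) - f (z.re + y * Complex.I) =
      ∫ x in z.re..w.re, g (x + y * Complex.I) := by
    intro y hy
    have h1 : ∀ x ∈ [[z.re, w.re]], HasDerivAt (fun x : ℝ => f (x + y * Complex.I))
        (g (x + y * Complex.I)) x := by
      intro x hx
      have h2 := hslope x hx y hy
      rw [show (x + y * Complex.I : ℂ) = y * Complex.I + x * 1 by ring] at h2 ⊢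
      have h3 := h2.hasDerivAt_comp_line
      rw [one_mul] at h3
      refine h3.congr_of_eventuallyEq (Eventually.of_forall fun s => ?_)
      simp only [mul_one, add_comm]
    rw [intervalIntegral.integral_eq_sub_of_hasDerivAt h1]
    simpa using hint (φ := fun x : ℝ => x + y * Complex.I) (by fun_prop) 1 z.re w.re
  have hswap : ∫ x in z.re..w.re, ∫ y in z.im..w.im, g (x + y * Complex.I) =
      ∫ y in z.im..w.im, ∫ x in z.re..w.re, g (x + y * Complex.I) := by
    apply intervalIntegral_intervalIntegral_swap
      (F := fun x y : ℝ => g (x + y * Complex.I))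
    refine Measure.integrableOn_of_bounded (M := max C 0) ?_ (Measurable.aestronglyMeasurable ?_)
      (Eventually.of_forall fun t => hgb _)
    · rw [Measure.volume_eq_prod, Measure.prod_prod]
      exact ENNReal.mul_ne_top (by simp) (by simp)
    · exact hgm.comp (by fun_prop)
  -- The horizontal and the vertical sides contribute the same double integral of `g`, times `I`,
  -- with opposite signs.
  rw [← add_eq_zero_iff_eq_neg, Complex.wedgeIntegral_add_wedgeIntegral_eq]
  have i1 : ∀ (y a b : ℝ), IntervalIntegrable (fun x : ℝ => f (x + y * Complex.I)) volume a b :=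
    fun y a b => Continuous.intervalIntegrable (by fun_prop) _ _
  have i2 : ∀ (x a b : ℝ), IntervalIntegrable (fun y : ℝ => f (x + y * Complex.I)) volume a b :=
    fun y a b => Continuous.intervalIntegrable (by fun_prop) _ _
  have e1 : (∫ x : ℝ in z.re..w.re, f (x + w.im * Complex.I)) -
      (∫ x : ℝ in z.re..w.re, f (x + z.im * Complex.I)) =
      Complex.I * ∫ x in z.re..w.re, ∫ y in z.im..w.im, g (x + y * Complex.I) := by
    rw [← intervalIntegral.integral_sub (i1 _ _ _) (i1 _ _ _),
      ← intervalIntegral.integral_const_mul]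
    refine intervalIntegral.integral_congr fun x hx => ?_
    simp only [hV x hx, intervalIntegral.integral_const_mul]
  have e2 : (∫ y : ℝ in z.im..w.im, f (w.re + y * Complex.I)) -
      (∫ y : ℝ in z.im..w.im, f (z.re + y * Complex.I)) =
      ∫ y in z.im..w.im, ∫ x in z.re..w.re, g (x + y * Complex.I) := by
    rw [← intervalIntegral.integral_sub (i2 _ _ _) (i2 _ _ _)]
    exact intervalIntegral.integral_congr fun y hy => hH y hy
  rw [hswap] at e1
  simp only [smul_eq_mul]
  linear_combination -e1 + Complex.I * e2

/-! ### A Phragmén-Lindelöf principle outside a sector -/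

/-- The argument of `w ^ (-1/4)` is at most `π / 4 < π / 3` in modulus, so its cosine is at least `1
/ 2`. -/
theorem norm_rpow_div_two_le_re_cpow (w : ℂ) :
    ‖w‖ ^ (-1 / 4 : ℝ) / 2 ≤ (w ^ (((-1 / 4 : ℝ)) : ℂ)).re := by
  rw [Complex.cpow_ofReal_re, div_eq_mul_one_div]
  refine mul_le_mul_of_nonneg_left ?_ (Real.rpow_nonneg (norm_nonneg _) _)
  rw [← Real.cos_pi_div_three, ← Real.cos_abs (w.arg * _)]
  refine Real.cos_le_cos_of_nonneg_of_le_pi (abs_nonneg _) (by linarith [Real.pi_pos]) ?_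
  rw [abs_mul, abs_of_neg (by norm_num : (-1 / 4 : ℝ) < 0)]
  linarith [Complex.abs_arg_le_pi w, Real.pi_pos]

/-- Outside the sector `σ` is never a positive real, so powers of `-σ` are holomorphic there. -/
theorem neg_mem_slitPlane_of_mul_re_le {σ : ℂ} {k : ℝ} (hk : 0 < k) (h0 : σ ≠ 0)
    (h : k * σ.re ≤ |σ.im|) : -σ ∈ Complex.slitPlane := by
  rw [Complex.mem_slitPlane_iff]
  by_cases hi : σ.im = 0
  · left
    rw [hi, abs_zero] at h
    have h1 : σ.re ≤ 0 := by by_contra h2; push Not at h2; linarith [mul_pos hk h2]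
    have h2 : σ.re ≠ 0 := fun h3 => h0 (Complex.ext h3 hi)
    simpa using lt_of_le_of_ne h1 h2
  · right; simpa using hi

/-- A Phragmén-Lindelöf principle: if `f` is holomorphic on a bounded open set `O` and the bound
`‖f ζ - f z‖ ≤ L * ‖ζ - z‖` holds on the frontier of `O` and on a sector with vertex `z`, then it
holds on `O`. -/
theorem norm_sub_le_of_frontier_of_sector {f : ℂ → ℂ} (hf : Continuous f) {O : Set ℂ}
    (hO : IsOpen O) (hOb : Bornology.IsBounded O) (hd : DifferentiableOn ℂ f O) {z m : ℂ}
    (hm : m ≠ 0) {k L : ℝ} (hk : 0 < k) (hL : 0 < L)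
    (hfr : ∀ ζ ∈ frontier O, ‖f ζ - f z‖ ≤ L * ‖ζ - z‖)
    (hsec : ∀ ζ ∈ O, |((ζ - z) / m).im| ≤ k * ((ζ - z) / m).re → ‖f ζ - f z‖ ≤ L * ‖ζ - z‖) :
    ∀ ζ ∈ O, ‖f ζ - f z‖ ≤ L * ‖ζ - z‖ := by
  intro ζ₀ hζ₀
  by_cases hs₀ : |((ζ₀ - z) / m).im| ≤ k * ((ζ₀ - z) / m).re
  · exact hsec ζ₀ hζ₀ hs₀
  push Not at hs₀
  have hne₀ : ζ₀ - z ≠ 0 := by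
    intro h; rw [h] at hs₀; simp at hs₀
  obtain ⟨A, hA⟩ : ∃ A, ∀ ζ ∈ closure O, ‖f ζ - f z‖ ≤ A := by
    obtain ⟨A, hA⟩ := hOb.isCompact_closure.exists_bound_of_continuousOn
      (f := fun ζ => f ζ - f z) (by fun_prop)
    exact ⟨A, hA⟩
  have hA0 : 0 ≤ A := (norm_nonneg _).trans (hA ζ₀ (subset_closure hζ₀))
  set σ : ℂ → ℂ := fun ζ => (ζ - z) / m with hσ
  have hσc : Continuous σ := by fun_prop
  have hσn : ∀ ζ, ‖ζ - z‖ = ‖m‖ * ‖σ ζ‖ := by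
    intro ζ
    rw [← norm_mul, hσ, mul_div_cancel₀ _ hm]
  -- Damping factor: bounded by `1`, and decaying faster than any power of `ζ - z` at the vertex.
  -- Any exponent in `(-1/2, 0)` keeps the real part positive.
  let H : ℝ → ℂ → ℂ := fun ε ζ => Complex.exp (-(ε : ℂ) * (-σ ζ) ^ (((-1 / 4 : ℝ)) : ℂ))
  have hH : ∀ ε ζ, 0 < ε → ‖H ε ζ‖ ≤ Real.exp (-(ε / 2) * ‖σ ζ‖ ^ (-1 / 4 : ℝ)) := by
    intro ε ζ hε
    rw [Complex.norm_exp, Real.exp_le_exp, ← Complex.ofReal_neg, Complex.re_ofReal_mul]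
    have h1 := norm_rpow_div_two_le_re_cpow (-σ ζ)
    rw [norm_neg] at h1
    nlinarith
  have hH1 : ∀ ε ζ, 0 < ε → ‖H ε ζ‖ ≤ 1 := by
    intro ε ζ hε
    refine (hH ε ζ hε).trans (Real.exp_le_one_iff.2 ?_)
    have := Real.rpow_nonneg (norm_nonneg (σ ζ)) (-1 / 4 : ℝ)
    nlinarith
  have key : ∀ ε : ℝ, 0 < ε → ‖H ε ζ₀ * ((f ζ₀ - f z) / (ζ₀ - z))‖ ≤ L := by
    intro ε hε
    -- A disc `‖σ‖ ≤ s⁻⁴` is cut out around `z`. On its boundary `‖σ‖ ^ (-1/4) = s`, and the decay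
    -- `exp (-ε s / 2)` beats the crude bound `A s⁴ / ‖m‖` of the quotient.
    obtain ⟨s, hs0, hs1, hs2⟩ : ∃ s : ℝ, 0 < s ∧ (s ^ 4)⁻¹ < ‖σ ζ₀‖ ∧
        Real.exp (-(ε / 2) * s) * (A / (‖m‖ * (s ^ 4)⁻¹)) ≤ L := by
      have t1 : Tendsto (fun s : ℝ => (s ^ 4)⁻¹) atTop (𝓝 0) :=
        (tendsto_pow_atTop (by norm_num)).inv_tendsto_atTop
      have t2 : Tendsto (fun s : ℝ => Real.exp (-(ε / 2) * s) * (A / (‖m‖ * (s ^ 4)⁻¹)))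
          atTop (𝓝 0) := by
        have t3 := (tendsto_rpow_mul_exp_neg_mul_atTop_nhds_zero 4 (ε / 2)
          (by positivity)).const_mul (A / ‖m‖)
        rw [mul_zero] at t3
        refine t3.congr' ?_
        filter_upwards [eventually_gt_atTop 0] with s hs
        have : s ^ (4 : ℝ) = s ^ 4 := by exact_mod_cast Real.rpow_natCast s 4
        rw [this]
        have hm' : ‖m‖ ≠ 0 := norm_ne_zero_iff.2 hm
        field_simp
      have hpos : 0 < ‖σ ζ₀‖ := norm_pos_iff.2 (div_ne_zero hne₀ hm)
      obtain ⟨s, h1, h2, h3⟩ := ((eventually_gt_atTop 0).and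
        ((t1.eventually_lt_const hpos).and (t2.eventually_le_const hL))).exists
      exact ⟨s, h1, h2, h3⟩
    have hsp : 0 < (s ^ 4)⁻¹ := by positivity
    set W := O ∩ {ζ | (s ^ 4)⁻¹ < ‖σ ζ‖ ∧ k * (σ ζ).re < |(σ ζ).im|} with hW
    set T := {ζ | (s ^ 4)⁻¹ ≤ ‖σ ζ‖ ∧ k * (σ ζ).re ≤ |(σ ζ).im|} with hT
    have hWo : IsOpen W := by
      refine hO.inter ((isOpen_lt ?_ ?_).and (isOpen_lt ?_ ?_)) <;> fun_prop
    have hTc : IsClosed T := by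
      refine (isClosed_le ?_ ?_).and (isClosed_le ?_ ?_) <;> fun_prop
    have hWT : closure W ⊆ T :=
      closure_minimal (fun ζ hζ => ⟨hζ.2.1.le, hζ.2.2.le⟩) hTc
    have hTs : ∀ ζ ∈ T, σ ζ ≠ 0 ∧ ζ - z ≠ 0 ∧ -σ ζ ∈ Complex.slitPlane := by
      intro ζ hζ
      have h0 : σ ζ ≠ 0 := norm_pos_iff.1 (hsp.trans_le hζ.1)
      exact ⟨h0, fun h => h0 (by simp [hσ, h]), neg_mem_slitPlane_of_mul_re_le hk h0 hζ.2⟩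
    have hdiff : DiffContOnCl ℂ (fun ζ => H ε ζ * ((f ζ - f z) / (ζ - z))) W := by
      constructor
      · intro ζ hζ
        obtain ⟨_, h1, h2⟩ := hTs ζ (hWT (subset_closure hζ))
        have h3 : DifferentiableAt ℂ f ζ := hd.differentiableAt (hO.mem_nhds hζ.1)
        have h4 : DifferentiableAt ℂ (H ε) ζ := by
          refine DifferentiableAt.cexp (DifferentiableAt.const_mul ?_ _)
          refine DifferentiableAt.cpow ?_ (differentiableAt_const _) h2
          simp only [hσ]
          fun_prop
        exact (h4.mul ((h3.sub_const _).div (by fun_prop) h1)).differentiableWithinAt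
      · intro ζ hζ
        obtain ⟨_, h1, h2⟩ := hTs ζ (hWT hζ)
        have h4 : ContinuousAt (H ε) ζ := by
          refine ContinuousAt.cexp (ContinuousAt.mul continuousAt_const ?_)
          exact ContinuousAt.cpow hσc.neg.continuousAt continuousAt_const h2
        exact (h4.mul ((hf.continuousAt.sub continuousAt_const).div (by fun_prop)
          h1)).continuousWithinAt
    refine Complex.norm_le_of_forall_mem_frontier_norm_le (hOb.subset inter_subset_left) hdiff
      (fun ζ hζ => ?_) (subset_closure (show ζ₀ ∈ W from ⟨hζ₀, hs1, hs₀⟩))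
    have hζc := frontier_subset_closure hζ
    have hζT := hWT hζc
    obtain ⟨hσ0, hz0, -⟩ := hTs ζ hζT
    have hcO : ζ ∈ closure O := closure_mono inter_subset_left hζc
    have hnW : ζ ∉ W := by
      rw [hWo.frontier_eq] at hζ; exact hζ.2
    rw [norm_mul, norm_div]
    have hest : ‖f ζ - f z‖ ≤ L * ‖ζ - z‖ →
        ‖H ε ζ‖ * (‖f ζ - f z‖ / ‖ζ - z‖) ≤ L := by
      intro h
      have h1 : ‖f ζ - f z‖ / ‖ζ - z‖ ≤ L := by
        rwa [div_le_iff₀ (norm_pos_iff.2 hz0)]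
      calc _ ≤ 1 * L := mul_le_mul (hH1 ε ζ hε) h1 (by positivity) zero_le_one
        _ = L := one_mul L
    by_cases hζO : ζ ∈ O
    · by_cases hsect : |(σ ζ).im| ≤ k * (σ ζ).re
      · exact hest (hsec ζ hζO hsect)
      · push Not at hsect
        have heq : ‖σ ζ‖ = (s ^ 4)⁻¹ := by
          refine le_antisymm ?_ hζT.1
          by_contra h
          push Not at h
          exact hnW ⟨hζO, h, hsect⟩
        have h1 := hH ε ζ hε
        have h2 : ‖σ ζ‖ ^ (-1 / 4 : ℝ) = s := by
          rw [heq, ← Real.rpow_natCast, ← Real.rpow_neg hs0.le, ← Real.rpow_mul hs0.le]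
          norm_num
        rw [h2] at h1
        refine le_trans (mul_le_mul h1 ?_ (by positivity) (Real.exp_nonneg _)) hs2
        rw [hσn ζ, heq]
        have : 0 < ‖m‖ := norm_pos_iff.2 hm
        exact div_le_div_of_nonneg_right (hA ζ hcO) (by positivity)
    · exact hest (hfr ζ (by rw [hO.frontier_eq]; exact ⟨hcO, hζO⟩))
  -- Removing the damping: `H ε ζ₀ → 1` as `ε → 0`.
  have hlim : Tendsto (fun ε : ℝ => ‖H ε ζ₀ * ((f ζ₀ - f z) / (ζ₀ - z))‖) (𝓝[>] 0)
      (𝓝 (‖f ζ₀ - f z‖ / ‖ζ₀ - z‖)) := by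
    have hc : Continuous fun ε : ℝ => ‖H ε ζ₀ * ((f ζ₀ - f z) / (ζ₀ - z))‖ := by
      fun_prop
    have := hc.tendsto 0
    simp only [H, Complex.ofReal_zero, neg_zero, zero_mul, Complex.exp_zero, one_mul,
      norm_div] at this
    exact this.mono_left nhdsWithin_le_nhds
  have := le_of_tendsto hlim (eventually_nhdsWithin_of_forall key)
  rwa [div_le_iff₀ (norm_pos_iff.2 hne₀)] at this

/-! ### Uniform bounds on a disc of directions -/

/-- The set of points at which the difference quotients of `f` with step `ε ≤ δ`, in all directions
of the disk of radius `η` about `m`, are bounded by `N`. -/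
def sectorBoundSet (f : ℂ → ℂ) (δ N : ℝ) (m : ℂ) (η : ℝ) : Set ℂ :=
  {z | ∀ u ∈ closedBall m η, ∀ ε ∈ Icc (0 : ℝ) δ, ‖f (z + ε * u) - f z‖ ≤ N * ε}

theorem isClosed_sectorBoundSet {f : ℂ → ℂ} (hf : Continuous f) (δ N : ℝ) (m : ℂ) (η : ℝ) :
    IsClosed (sectorBoundSet f δ N m η) := by
  simp only [sectorBoundSet, ofPred_forall]
  refine isClosed_iInter fun u => isClosed_iInter fun _ => isClosed_iInter fun ε =>
    isClosed_iInter fun _ => isClosed_le ?_ ?_ <;> fun_prop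

theorem HasGateauxSlopeAt.exists_bound {f : ℂ → ℂ} {c z : ℂ} (h : HasGateauxSlopeAt f c z)
    (u : ℂ) : ∃ n : ℕ, ∀ ε ∈ Icc (0 : ℝ) (1 / (n + 1)), ‖f (z + ε * u) - f z‖ ≤ n * ε := by
  obtain ⟨C, hC⟩ := (h u).isBigO_sub.bound
  obtain ⟨r, hr, hb⟩ := Metric.eventually_nhds_iff.1 hC
  obtain ⟨n₁, hn₁⟩ := exists_nat_one_div_lt hr
  obtain ⟨n₂, hn₂⟩ := exists_nat_ge C
  refine ⟨max n₁ n₂, fun ε hε => ?_⟩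
  have h1 : (1 : ℝ) / ((max n₁ n₂ : ℕ) + 1) ≤ 1 / (n₁ + 1) := by
    apply one_div_le_one_div_of_le (by positivity)
    gcongr
    exact le_max_left _ _
  have h2 := hb (y := ε) (by
    rw [Real.dist_eq, sub_zero, abs_of_nonneg hε.1]
    linarith [hε.2])
  simp only [Complex.ofReal_zero, zero_mul, add_zero, sub_zero, Real.norm_eq_abs,
    abs_of_nonneg hε.1] at h2
  refine h2.trans (mul_le_mul_of_nonneg_right (hn₂.trans ?_) hε.1)
  exact_mod_cast le_max_right _ _

/-- Baire's theorem in the plane of directions `u` gives one bound on a whole disc of them. Taking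
centres from a dense sequence and radii `1 / (j + 1)` leaves countably many sets, ready for Baire's
theorem in `z`. -/
theorem HasGateauxSlopeAt.exists_mem_sectorBoundSet {f : ℂ → ℂ} (hf : Continuous f) {c z : ℂ}
    (h : HasGateauxSlopeAt f c z) : ∃ n p j : ℕ, TopologicalSpace.denseSeq ℂ p ≠ 0 ∧
      z ∈ sectorBoundSet f (1 / (n + 1)) n (TopologicalSpace.denseSeq ℂ p) (1 / (j + 1)) := by
  let S : ℕ → Set ℂ := fun n =>
    {u | ∀ ε ∈ Icc (0 : ℝ) (1 / (n + 1)), ‖f (z + ε * u) - f z‖ ≤ n * ε}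
  have hS : ∀ n, IsClosed (S n) := by
    intro n
    simp only [S, ofPred_forall]
    refine isClosed_iInter fun ε => isClosed_iInter fun _ => isClosed_le ?_ ?_ <;> fun_prop
  obtain ⟨n, hn⟩ := nonempty_interior_of_iUnion_of_closed hS
    (eq_univ_of_forall fun u => mem_iUnion.2 (h.exists_bound u))
  have ho : IsOpen (interior (S n) ∩ {0}ᶜ) := isOpen_interior.inter isOpen_compl_singleton
  have hne : (interior (S n) ∩ {0}ᶜ).Nonempty :=
    (dense_compl_singleton (0 : ℂ)).inter_open_nonempty _ isOpen_interior hn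
  obtain ⟨p, hp⟩ := (TopologicalSpace.denseRange_denseSeq ℂ).exists_mem_open ho hne
  obtain ⟨r, hr, hb⟩ := Metric.isOpen_iff.1 isOpen_interior _ hp.1
  obtain ⟨j, hj⟩ := exists_nat_one_div_lt hr
  exact ⟨n, p, j, hp.2, fun u hu => interior_subset (hb (closedBall_subset_ball hj hu))⟩

/-- With `t = ‖z - z'‖ / η`, the point `z' + t m` is reached from both points in time `t` along
directions within `η` of `m`. -/
theorem norm_sub_le_of_mem_sectorBoundSet {f : ℂ → ℂ} {δ N η : ℝ} {m z z' : ℂ} (hη : 0 < η)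
    (hz : z ∈ sectorBoundSet f δ N m η) (hz' : z' ∈ sectorBoundSet f δ N m η)
    (hd : ‖z - z'‖ ≤ η * δ) : ‖f z - f z'‖ ≤ 2 * N / η * ‖z - z'‖ := by
  by_cases hne : z = z'
  · simp [hne]
  have hpos : 0 < ‖z - z'‖ := norm_pos_iff.2 (sub_ne_zero.2 hne)
  set t := ‖z - z'‖ / η with ht
  have ht0 : 0 < t := div_pos hpos hη
  have htδ : t ∈ Icc 0 δ := ⟨ht0.le, by rw [ht, div_le_iff₀ hη]; linarith⟩
  have h1 := hz' m (mem_closedBall_self hη.le) t htδ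
  have h2 := hz (m + (z' - z) / t) (by
    rw [mem_closedBall, dist_eq_norm, add_sub_cancel_left, norm_div, Complex.norm_real,
      Real.norm_of_nonneg ht0.le, norm_sub_rev, ht]
    exact (div_div_cancel₀ hpos.ne').le) t htδ
  have h3 : z + t * (m + (z' - z) / t) = z' + t * m := by
    have : (t : ℂ) ≠ 0 := by exact_mod_cast ht0.ne'
    field_simp
    ring
  rw [h3] at h2
  calc ‖f z - f z'‖ ≤ ‖f (z' + t * m) - f z‖ + ‖f (z' + t * m) - f z'‖ := by
        rw [show f z - f z' = (f (z' + t * m) - f z') - (f (z' + t * m) - f z) by ring,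
          add_comm ‖f (z' + t * m) - f z‖]
        exact norm_sub_le (f (z' + t * m) - f z') (f (z' + t * m) - f z)
    _ ≤ N * t + N * t := add_le_add h2 h1
    _ = 2 * N / η * ‖z - z'‖ := by rw [ht]; ring

/-- For `σ = (ζ - z) / m`, the point `ζ` is reached from `z` in time `Re σ`, in a direction at
distance `‖m‖ |Im σ| / Re σ ≤ η` from `m`. -/
theorem norm_sub_le_of_mem_sector {f : ℂ → ℂ} {δ N η : ℝ} {m z ζ : ℂ} (hm : m ≠ 0)
    (hN : 0 ≤ N) (hη : 0 < η) (hz : z ∈ sectorBoundSet f δ N m η) (hd : ‖ζ - z‖ ≤ ‖m‖ * δ)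
    (hs : |((ζ - z) / m).im| ≤ η / ‖m‖ * ((ζ - z) / m).re) :
    ‖f ζ - f z‖ ≤ N / ‖m‖ * ‖ζ - z‖ := by
  have hm' : 0 < ‖m‖ := norm_pos_iff.2 hm
  set σ := (ζ - z) / m with hσ
  have hσn : ‖σ‖ = ‖ζ - z‖ / ‖m‖ := norm_div _ _
  have hre : 0 ≤ σ.re := nonneg_of_mul_nonneg_right ((abs_nonneg _).trans hs) (by positivity)
  have hre' : σ.re ≤ ‖ζ - z‖ / ‖m‖ := hσn ▸ Complex.re_le_norm σ
  rcases hre.eq_or_lt with h0 | h0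
  · rw [← h0, mul_zero] at hs
    have : σ = 0 := Complex.ext h0.symm (abs_eq_zero.1 (le_antisymm hs (abs_nonneg _)))
    have h1 : ζ - z = 0 := by
      rw [hσ] at this
      exact (div_eq_zero_iff.1 this).resolve_right hm
    simp [sub_eq_zero.1 h1]
  · have h0' : (σ.re : ℂ) ≠ 0 := by exact_mod_cast h0.ne'
    have h1 := hz ((ζ - z) / σ.re) (by
      rw [mem_closedBall, dist_eq_norm]
      have h2 : (ζ - z) / σ.re - m = m * ((σ.im : ℂ) * Complex.I) / σ.re := by
        have h3 : ζ - z = m * σ := by rw [hσ, mul_div_cancel₀ _ hm]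
        rw [h3, div_sub' h0']
        congr 1
        linear_combination m * (Complex.re_add_im σ).symm
      rw [h2, norm_div, norm_mul, norm_mul, Complex.norm_I, mul_one, Complex.norm_real,
        Complex.norm_real, Real.norm_of_nonneg hre, div_le_iff₀ h0, Real.norm_eq_abs]
      calc ‖m‖ * |σ.im| ≤ ‖m‖ * (η / ‖m‖ * σ.re) := by gcongr
        _ = η * σ.re := by field_simp) σ.re ⟨hre, hre'.trans (by
          rw [div_le_iff₀ hm']; linarith)⟩
    rw [mul_div_cancel₀ _ h0', add_sub_cancel] at h1
    calc _ ≤ N * σ.re := h1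
      _ ≤ N * (‖ζ - z‖ / ‖m‖) := by gcongr
      _ = _ := by ring

/-- The Lipschitz bound between points of `E` extends to pairs with only one point in `E`, by the
Phragmén-Lindelöf principle. Off `V` it bounds the slope directly; on `V`, Cauchy's estimate on the
disc reaching to the nearest point of `E` does. -/
theorem exists_bound_of_compl_subset_sectorBoundSet {f c : ℂ → ℂ} (hf : Continuous f) {V : Set ℂ}
    (hV : IsOpen V) (hd : ∀ z ∈ V, DifferentiableAt ℂ f z) {z₀ m : ℂ} {R δ N η : ℝ} (hR : 0 < R)
    (hδ : 0 < δ) (hN : 0 ≤ N) (hη : 0 < η) (hm : m ≠ 0) (hz₀ : z₀ ∉ V)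
    (hc : ∀ z ∈ ball z₀ R, HasGateauxSlopeAt f (c z) z)
    (hK : ball z₀ R \ V ⊆ sectorBoundSet f δ N m η) :
    ∃ r > 0, ∃ C, ∀ z ∈ ball z₀ r, ‖c z‖ ≤ C := by
  have hm' : 0 < ‖m‖ := norm_pos_iff.2 hm
  obtain ⟨r, hr, hrR, hr1, hr2⟩ : ∃ r > 0, r < R ∧ 2 * r ≤ ‖m‖ * δ ∧ 2 * r ≤ η * δ := by
    refine ⟨min (R / 2) (min (‖m‖ * δ / 2) (η * δ / 2)), by positivity, ?_, ?_, ?_⟩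
    · exact (min_le_left _ _).trans_lt (by linarith)
    · linarith [(min_le_right (R / 2) _).trans (min_le_left (‖m‖ * δ / 2) (η * δ / 2))]
    · linarith [(min_le_right (R / 2) _).trans (min_le_right (‖m‖ * δ / 2) (η * δ / 2))]
  have hball : closedBall z₀ r ⊆ ball z₀ R := closedBall_subset_ball hrR
  set E := closedBall z₀ r \ V with hE
  have hEc : IsCompact E := (isCompact_closedBall z₀ r).diff hV
  have hEK : E ⊆ sectorBoundSet f δ N m η := fun z hz => hK ⟨hball hz.1, hz.2⟩
  have hdist : ∀ z ∈ closedBall z₀ r, ∀ z' ∈ closedBall z₀ r, ‖z - z'‖ ≤ 2 * r := by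
    intro z hz z' hz'
    rw [← dist_eq_norm]
    linarith [dist_triangle_right z z' z₀, mem_closedBall.1 hz, mem_closedBall.1 hz']
  obtain ⟨A, hA⟩ := (isCompact_closedBall z₀ r).exists_bound_of_continuousOn hf.continuousOn
  have hA0 : 0 ≤ A := (norm_nonneg _).trans (hA z₀ (mem_closedBall_self hr.le))
  -- The three bounds serve pairs in `E`, the sector, and the outer circle, where `‖f w - f z‖ ≤ 2A`
  -- and `‖w - z‖ ≥ r / 2`.
  obtain ⟨L, hL, hL1, hL2, hL3⟩ : ∃ L > 0, 2 * N / η ≤ L ∧ N / ‖m‖ ≤ L ∧ 4 * A / r ≤ L := by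
    have h1 : 0 ≤ 2 * N / η := by positivity
    have h2 : 0 ≤ N / ‖m‖ := by positivity
    have h3 : 0 ≤ 4 * A / r := by positivity
    exact ⟨2 * N / η + N / ‖m‖ + 4 * A / r + 1, by linarith, by linarith, by linarith,
      by linarith⟩
  have hEE : ∀ z ∈ E, ∀ z' ∈ E, ‖f z - f z'‖ ≤ L * ‖z - z'‖ := fun z hz z' hz' =>
    (norm_sub_le_of_mem_sectorBoundSet hη (hEK hz) (hEK hz')
      ((hdist z hz.1 z' hz'.1).trans hr2)).trans (by gcongr)
  have hlip : ∀ z ∈ E, z ∈ closedBall z₀ (r / 2) → ∀ ζ ∈ ball z₀ r,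
      ‖f ζ - f z‖ ≤ L * ‖ζ - z‖ := by
    intro z hz hzr ζ hζ
    by_cases hζV : ζ ∈ V
    · refine norm_sub_le_of_frontier_of_sector hf (isOpen_ball.inter hV)
        (isBounded_ball.subset inter_subset_left)
        (fun w hw => (hd w hw.2).differentiableWithinAt) hm (k := η / ‖m‖) (by positivity) hL
        (fun w hw => ?_) (fun w hw hs => ?_) ζ ⟨hζ, hζV⟩
      · have hwc : w ∈ closedBall z₀ r := closure_ball_subset_closedBall
          (closure_mono inter_subset_left (frontier_subset_closure hw))
        by_cases hwV : w ∈ V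
        · have hwb : w ∉ ball z₀ r := by
            rw [(isOpen_ball.inter hV).frontier_eq] at hw
            exact fun h => hw.2 ⟨h, hwV⟩
          have h1 : r / 2 ≤ ‖w - z‖ := by
            rw [← dist_eq_norm]
            rw [mem_ball, not_lt] at hwb
            linarith [dist_triangle w z z₀, mem_closedBall.1 hzr]
          calc ‖f w - f z‖ ≤ A + A := (norm_sub_le _ _).trans (add_le_add (hA w hwc) (hA z hz.1))
            _ = 4 * A / r * (r / 2) := by field_simp; ring
            _ ≤ L * ‖w - z‖ := mul_le_mul hL3 h1 (by positivity) hL.le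
        · exact hEE w ⟨hwc, hwV⟩ z hz
      · exact (norm_sub_le_of_mem_sector hm hN hη (hEK hz)
          ((hdist w (ball_subset_closedBall hw.1) z hz.1).trans hr1) hs).trans (by gcongr)
    · exact hEE ζ ⟨ball_subset_closedBall hζ, hζV⟩ z hz
  have hz₀E : z₀ ∈ E := ⟨mem_closedBall_self hr.le, hz₀⟩
  refine ⟨r / 8, by positivity, 2 * L, fun w hw => ?_⟩
  have hwd : dist w z₀ < r / 8 := hw
  have hwr : w ∈ ball z₀ r := ball_subset_ball (by linarith) hw
  have hcw := hc w (hball (ball_subset_closedBall hwr))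
  by_cases hwV : w ∈ V
  · obtain ⟨z, hzE, hz⟩ := hEc.exists_infDist_eq_dist ⟨z₀, hz₀E⟩ w
    set d := dist w z with hdd
    have hd1 : d < r / 8 := by
      rw [← hz]; exact (infDist_le_dist_of_mem hz₀E).trans_lt hwd
    have hd0 : 0 < d := dist_pos.2 fun h => hzE.2 (h ▸ hwV)
    have hzr : z ∈ closedBall z₀ (r / 2) := by
      rw [mem_closedBall]
      linarith [dist_triangle_left z z₀ w]
    have hsub : closedBall w d ⊆ ball z₀ r := by
      intro ζ hζ
      rw [mem_ball]
      linarith [dist_triangle ζ w z₀, mem_closedBall.1 hζ]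
    have hdc : DiffContOnCl ℂ (fun ζ => f ζ - f z) (ball w d) := by
      refine ⟨fun ζ hζ => ?_, by fun_prop⟩
      have hζV : ζ ∈ V := by
        by_contra h
        have h1 := infDist_le_dist_of_mem (x := w)
          (show ζ ∈ E from ⟨ball_subset_closedBall (hsub (ball_subset_closedBall hζ)), h⟩)
        rw [hz, dist_comm] at h1
        exact absurd (mem_ball.1 hζ) (not_lt.2 h1)
      exact ((hd ζ hζV).sub_const _).differentiableWithinAt
    have h1 := Complex.norm_deriv_le_of_forall_mem_sphere_norm_le (C := L * (2 * d)) hd0 hdc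
      (fun ζ hζ => (hlip z hzE hzr ζ (hsub (sphere_subset_closedBall hζ))).trans (by
        gcongr
        rw [← dist_eq_norm]
        linarith [dist_triangle ζ w z, mem_sphere.1 hζ]))
    rw [deriv_sub_const, ← hcw.eq_deriv (hd w hwV)] at h1
    refine h1.trans (le_of_eq ?_)
    field_simp
  · have h1 := hcw 1
    have h2 : ‖1 * c w‖ ≤ L := by
      refine h1.le_of_lip' hL.le ?_
      have h3 : Tendsto (fun t : ℝ => w + t * 1) (𝓝 0) (𝓝 w) := by
        have : Continuous (fun t : ℝ => w + (t : ℂ) * 1) := by fun_prop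
        simpa using this.tendsto 0
      filter_upwards [h3.eventually (isOpen_ball.mem_nhds hwr)] with t ht
      have h4 := hlip w ⟨ball_subset_closedBall hwr, hwV⟩
        (ball_subset_closedBall (ball_subset_ball (by linarith) hw)) _ ht
      simpa using h4
    rw [one_mul] at h2
    linarith

/-! ### Holomorphy without a bound on the slope -/

/-- A continuous function on the plane that has a complex-linear Gateaux derivative at every point
of an open set is holomorphic there. -/
theorem differentiableOn_of_continuous_of_gateaux {f c : ℂ → ℂ} (hf : Continuous f) {U : Set ℂ}
    (hU : IsOpen U) (h : ∀ z ∈ U, HasGateauxSlopeAt f (c z) z) : DifferentiableOn ℂ f U := by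
  set V := {z | ∀ᶠ w in 𝓝 z, DifferentiableAt ℂ f w} with hV
  have hVo : IsOpen V := isOpen_setOfPred_eventually_nhds
  have hVd : ∀ z ∈ V, DifferentiableAt ℂ f z := fun z hz => hz.self_of_nhds
  suffices hUV : U ⊆ V from fun z hz => (hVd z (hUV hz)).differentiableWithinAt
  by_contra hUV
  obtain ⟨z₁, hz₁U, hz₁V⟩ := not_subset.1 hUV
  -- A locally closed subset of the plane is locally compact, hence a Baire space.
  have hlc : IsLocallyClosed (U ∩ Vᶜ) := hU.isLocallyClosed.inter hVo.isClosed_compl.isLocallyClosed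
  have : LocallyCompactSpace ↥(U ∩ Vᶜ) := hlc.locallyCompactSpace
  have : Nonempty ↥(U ∩ Vᶜ) := ⟨⟨z₁, hz₁U, hz₁V⟩⟩
  let K : ℕ × ℕ × ℕ → Set ↥(U ∩ Vᶜ) := fun i => Subtype.val ⁻¹'
    ({_z | TopologicalSpace.denseSeq ℂ i.2.1 ≠ 0} ∩ sectorBoundSet f (1 / (i.1 + 1)) i.1
      (TopologicalSpace.denseSeq ℂ i.2.1) (1 / (i.2.2 + 1)))
  have hKc : ∀ i, IsClosed (K i) := fun i =>
    (isClosed_const.inter (isClosed_sectorBoundSet hf _ _ _ _)).preimage continuous_subtype_val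
  have hKu : ⋃ i, K i = univ := by
    refine eq_univ_of_forall fun z => mem_iUnion.2 ?_
    obtain ⟨n, p, j, h1, h2⟩ := (h z.1 z.2.1).exists_mem_sectorBoundSet hf
    exact ⟨⟨n, p, j⟩, h1, h2⟩
  obtain ⟨i, z₀, hi⟩ := nonempty_interior_of_iUnion_of_closed hKc hKu
  have hm := (interior_subset hi).1
  obtain ⟨R₁, hR₁, hb₁⟩ := Metric.isOpen_iff.1 isOpen_interior _ hi
  obtain ⟨R₂, hR₂, hb₂⟩ := Metric.isOpen_iff.1 hU _ z₀.2.1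
  have hR : 0 < min R₁ R₂ := lt_min hR₁ hR₂
  obtain ⟨r, hr, C, hC⟩ := exists_bound_of_compl_subset_sectorBoundSet (c := c)
    (δ := 1 / (i.1 + 1)) (N := i.1) (m := TopologicalSpace.denseSeq ℂ i.2.1)
    (η := 1 / (i.2.2 + 1)) hf hVo hVd hR (by positivity) (by positivity) (by positivity) hm z₀.2.2
    (fun z hz => h z (hb₂ (ball_subset_ball (min_le_right _ _) hz)))
    (fun z hz => by
      have hzU : z ∈ U := hb₂ (ball_subset_ball (min_le_right _ _) hz.1)
      have hzb : (⟨z, hzU, hz.2⟩ : ↥(U ∩ Vᶜ)) ∈ ball z₀ R₁ :=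
        ball_subset_ball (min_le_left _ _) hz.1
      exact (interior_subset (hb₁ hzb)).2)
  have hr' : 0 < min r R₂ := lt_min hr hR₂
  have hdiff := differentiableOn_of_bounded_gateaux hf (U := ball z₀.1 (min r R₂)) isOpen_ball
    (fun z hz => h z (hb₂ (ball_subset_ball (min_le_right _ _) hz)))
    (fun z hz => hC z (ball_subset_ball (min_le_left _ _) hz))
  refine z₀.2.2 ?_
  filter_upwards [isOpen_ball.mem_nhds (mem_ball_self hr')] with w hw
  exact hdiff.differentiableAt (isOpen_ball.mem_nhds hw)

/-- A continuous function that has a complex-linear Gateaux derivative at every point of an open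
set is holomorphic there. -/
theorem differentiableOn_of_gateaux {f c : ℂ → ℂ} {U : Set ℂ} (hU : IsOpen U)
    (hf : ContinuousOn f U) (h : ∀ z ∈ U, HasGateauxSlopeAt f (c z) z) :
    DifferentiableOn ℂ f U := by
  intro z hz
  obtain ⟨r, hr, hb⟩ := Metric.nhds_basis_closedBall.mem_iff.1 (hU.mem_nhds hz)
  -- Tietze's theorem extends `f` from a closed disc to the plane.
  obtain ⟨g, hg⟩ := ContinuousMap.exists_restrict_eq (isClosed_closedBall (x := z) (ε := r))
    ⟨_, (hf.mono hb).domRestrict⟩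
  have hgf : ∀ w ∈ closedBall z r, g w = f w := fun w hw =>
    DFunLike.congr_fun hg (⟨w, hw⟩ : closedBall z r)
  have hev : ∀ w ∈ ball z r, g =ᶠ[𝓝 w] f := fun w hw =>
    eventually_of_mem (isOpen_ball.mem_nhds hw) fun v hv => hgf v (ball_subset_closedBall hv)
  have h1 := differentiableOn_of_continuous_of_gateaux (c := c) g.continuous
    (isOpen_ball (x := z) (ε := r))
    fun w hw => (h w (hb (ball_subset_closedBall hw))).congr (hev w hw)
  have h2 := h1.differentiableAt (isOpen_ball.mem_nhds (mem_ball_self hr))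
  exact ((hev z (mem_ball_self hr)).differentiableAt_iff.1 h2).differentiableWithinAt

/-! ### Functions that factor through a linear map onto the plane -/

section Directional

variable {E : Type*} [NormedAddCommGroup E] [NormedSpace ℝ E]

/-- The left-hand limit along `v` is the negated right-hand limit along `-v`, and `ℓ` is odd. -/
theorem hasDerivAt_line_of_tendsto {ℓ : E →ₗ[ℝ] ℂ} {V : E → ℂ} {c : ℂ} {p : E}
    (h : ∀ v, Tendsto (fun ε : ℝ => ε⁻¹ • (V (p + ε • v) - V p)) (𝓝[>] 0) (𝓝 (ℓ v * c))) (v : E) :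
    HasDerivAt (fun t : ℝ => V (p + t • v)) (ℓ v * c) 0 := by
  rw [hasDerivAt_iff_tendsto_slope_zero, ← nhdsLT_sup_nhdsGT, tendsto_sup]
  simp only [zero_add, zero_smul, add_zero]
  refine ⟨?_, h v⟩
  have h1 : Tendsto (fun ε : ℝ => -ε) (𝓝[<] 0) (𝓝[>] 0) := by
    simpa using tendsto_neg_nhdsLT (a := (0 : ℝ))
  have h2 := ((h (-v)).comp h1).neg
  rw [map_neg, neg_mul, neg_neg] at h2
  refine h2.congr fun ε => ?_
  simp [inv_neg]

/-- The direction `q - p` lies in `ker ℓ`, so the derivative along the segment is zero. -/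
theorem eq_of_segment_subset {ℓ : E →ₗ[ℝ] ℂ} {V c : E → ℂ} {Ω : Set E} (hV : ContinuousOn V Ω)
    (h : ∀ p ∈ Ω, ∀ v, HasDerivAt (fun t : ℝ => V (p + t • v)) (ℓ v * c p) 0) {p q : E}
    (hpq : ℓ p = ℓ q) (hs : segment ℝ p q ⊆ Ω) : V p = V q := by
  have hmem : ∀ t ∈ Icc (0 : ℝ) 1, p + t • (q - p) ∈ Ω := fun t ht =>
    hs (by rw [segment_eq_image']; exact ⟨t, ht, rfl⟩)
  have h1 := constant_of_has_deriv_right_zero (f := fun t : ℝ => V (p + t • (q - p)))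
    (a := 0) (b := 1) (hV.comp (by fun_prop) hmem) (fun t ht => by
      have h2 := h _ (hmem t (Ico_subset_Icc_self ht)) (q - p)
      rw [map_sub, hpq, sub_self, zero_mul] at h2
      have h3 := HasDerivAt.scomp_of_eq t h2 ((hasDerivAt_id t).sub_const t) (sub_self t).symm
      rw [smul_zero] at h3
      refine HasDerivAt.hasDerivWithinAt (h3.congr_of_eventuallyEq
        (Eventually.of_forall fun s => ?_))
      simp only [Function.comp_apply, id_eq]
      congr 1
      module) 1 (by simp)
  simpa using h1.symm

/-- A continuous function on an open set `Ω`, convex in the direction of the kernel of a linear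
map `ℓ` onto `ℂ`, whose directional derivatives are `ℓ v * c`, is an analytic function of `ℓ`. -/
theorem exists_analyticOnNhd_comp_linearMap {ℓ : E →ₗ[ℝ] ℂ} (hℓ : Function.Surjective ℓ)
    {V c : E → ℂ} {Ω : Set E} (hΩ : IsOpen Ω) (hV : ContinuousOn V Ω)
    (hseg : ∀ p ∈ Ω, ∀ q ∈ Ω, ℓ p = ℓ q → segment ℝ p q ⊆ Ω)
    (h : ∀ p ∈ Ω, ∀ v, Tendsto (fun ε : ℝ => ε⁻¹ • (V (p + ε • v) - V p)) (𝓝[>] 0)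
      (𝓝 (ℓ v * c p))) :
    ∃ F : ℂ → ℂ, AnalyticOnNhd ℂ F (ℓ '' Ω) ∧ ∀ p ∈ Ω, V p = F (ℓ p) := by
  have hd : ∀ p ∈ Ω, ∀ v, HasDerivAt (fun t : ℝ => V (p + t • v)) (ℓ v * c p) 0 :=
    fun p hp => hasDerivAt_line_of_tendsto (h p hp)
  let ρ : ℂ → E := Function.invFunOn ℓ Ω
  have hρm : ∀ w ∈ ℓ '' Ω, ρ w ∈ Ω := fun w hw => Function.invFunOn_mem hw
  have hρe : ∀ w ∈ ℓ '' Ω, ℓ (ρ w) = w := fun w hw => Function.invFunOn_eq hw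
  have hF : ∀ p ∈ Ω, V p = V (ρ (ℓ p)) := fun p hp => by
    have hw := mem_image_of_mem ℓ hp
    exact eq_of_segment_subset hV hd (hρe _ hw).symm (hseg p hp _ (hρm _ hw) (hρe _ hw).symm)
  refine ⟨V ∘ ρ, ?_, hF⟩
  -- The section `ρ` need not be continuous. A linear section `s` gives the local formula `F w = V
  -- (p + s (w - ℓ p))`, from which `F` inherits continuity and slopes.
  obtain ⟨s', hs'⟩ := ℓ.exists_rightInverse_of_surjective (LinearMap.range_eq_top.2 hℓ)
  let s : ℂ →L[ℝ] E := s'.toContinuousLinearMap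
  have hs : ∀ w, ℓ (s w) = w := fun w => LinearMap.congr_fun hs' w
  have hnear : ∀ p ∈ Ω, ∀ᶠ w in 𝓝 (ℓ p), p + s (w - ℓ p) ∈ Ω := by
    intro p hp
    have h1 : Continuous fun w => p + s (w - ℓ p) := by fun_prop
    refine (h1.tendsto (ℓ p)).eventually (hΩ.mem_nhds ?_)
    simpa using hp
  have hloc : ∀ p ∈ Ω, V ∘ ρ =ᶠ[𝓝 (ℓ p)] fun w => V (p + s (w - ℓ p)) := by
    intro p hp
    filter_upwards [hnear p hp] with w hw
    rw [hF _ hw]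
    simp [hs]
  have hopen : IsOpen (ℓ '' Ω) := by
    rw [isOpen_iff_mem_nhds]
    rintro _ ⟨p, hp, rfl⟩
    filter_upwards [hnear p hp] with w hw
    exact ⟨_, hw, by simp [hs]⟩
  have hcont : ContinuousOn (V ∘ ρ) (ℓ '' Ω) := by
    rintro _ ⟨p, hp, rfl⟩
    refine ContinuousAt.continuousWithinAt (ContinuousAt.congr ?_ (hloc p hp).symm)
    have h1 : ContinuousAt (fun w => p + s (w - ℓ p)) (ℓ p) := by fun_prop
    exact ContinuousAt.comp_of_eq (hV.continuousAt (hΩ.mem_nhds hp)) h1 (by simp)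
  refine DifferentiableOn.analyticOnNhd (differentiableOn_of_gateaux (c := c ∘ ρ) hopen hcont
    fun w hw => ?_) hopen
  have hw' := hloc _ (hρm w hw)
  rw [hρe w hw] at hw'
  refine HasGateauxSlopeAt.congr (fun u => ?_) hw'
  have h1 := hd _ (hρm w hw) (s u)
  rw [hs] at h1
  refine h1.congr_of_eventuallyEq (Eventually.of_forall fun t => ?_)
  simp only [add_sub_cancel_left]
  rw [← Complex.real_smul, map_smul]

end Directional

/-! ### Coordinates in the complex quaternions -/

theorem continuous_coordEquiv_apply (k : Fin 4) : Continuous fun q : HC => coordEquiv q k := by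
  refine AddMonoidHomClass.continuous_of_bound (basisE.coord k) 1 fun q => ?_
  rw [one_mul, norm_eq]
  refine Real.le_sqrt_of_sq_le ?_
  exact Finset.single_le_sum (f := fun k => ‖basisE.repr q k‖ ^ 2) (fun _ _ => by positivity)
    (Finset.mem_univ k)

theorem continuous_of_coordEquiv {X : Type*} [TopologicalSpace X] {g : X → HC}
    (hg : ∀ k, Continuous fun x => coordEquiv (g x) k) : Continuous g :=
  continuous_induced_rng.2 ((PiLp.continuous_toLp 2 _).comp (continuous_pi hg))

theorem coordEquiv_real_smul (t : ℝ) (q : HC) : coordEquiv (t • q) = t • coordEquiv q := by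
  ext k; fin_cases k <;> simp [coordEquiv]

theorem f₁_apply (q : HC) : f₁ q = coordEquiv q 0 + coordEquiv q 2 := by
  rw [f₁, Module.Basis.constr_apply_fintype]
  simp [Fin.sum_univ_four, basisE]

theorem f₂_apply (q : HC) : f₂ q = coordEquiv q 1 + coordEquiv q 3 := by
  rw [f₂, Module.Basis.constr_apply_fintype]
  simp [Fin.sum_univ_four, basisE]

/-- `xi a b` as a real-linear map. -/
noncomputable def xiLinear (a b : ℂ) : EuclideanSpace ℝ (Fin 3) →ₗ[ℝ] ℂ where
  toFun := xi a b
  map_add' p q := by simp [xi]; ring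
  map_smul' t p := by simp [xi]; ring

theorem coordEquiv_zeta (a₁ a₂ b₁ b₂ : ℂ) (p : EuclideanSpace ℝ (Fin 3)) :
    coordEquiv (zeta (vec a₁ a₂) (vec b₁ b₂) p) = ![xi a₁ b₁ p, xi a₂ b₂ p, 0, 0] := by
  ext k
  fin_cases k <;> simp [coordEquiv, zeta, vec, xi, e₁, e₂] <;> ring_nf <;> simp <;> ring

/-- `e₁` and `e₂` are orthogonal idempotents with `e₁ e₃ = e₃`, `e₂ e₄ = e₄` and `e₁ e₄ = e₂ e₃ =
0`. -/
theorem coordEquiv_zeta_mul (a₁ a₂ b₁ b₂ : ℂ) (p : EuclideanSpace ℝ (Fin 3)) (q : HC) :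
    coordEquiv (zeta (vec a₁ a₂) (vec b₁ b₂) p * q) =
      ![xi a₁ b₁ p * coordEquiv q 0, xi a₂ b₂ p * coordEquiv q 1, xi a₁ b₁ p * coordEquiv q 2,
        xi a₂ b₂ p * coordEquiv q 3] := by
  have h : zeta (vec a₁ a₂) (vec b₁ b₂) p = xi a₁ b₁ p • e₁ + xi a₂ b₂ p • e₂ := by
    apply coordEquiv.injective
    rw [coordEquiv_zeta]
    ext k
    fin_cases k <;> simp [coordEquiv, e₁, e₂] <;> ring_nf <;> simp <;> ring
  rw [h]
  ext k
  fin_cases k <;> simp [coordEquiv, e₁, e₂] <;> ring_nf <;> simp <;> ring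

theorem zeta_add_smul (i₂ i₃ : HC) (p v : EuclideanSpace ℝ (Fin 3)) (t : ℝ) :
    zeta i₂ i₃ (p + t • v) = zeta i₂ i₃ p + t • zeta i₂ i₃ v := by
  simp only [zeta, PiLp.add_apply, PiLp.smul_apply, smul_eq_mul]
  module

theorem continuous_xi (a b : ℂ) : Continuous (xi a b) := by
  unfold xi; fun_prop

theorem continuous_zeta (a₁ a₂ b₁ b₂ : ℂ) : Continuous (zeta (vec a₁ a₂) (vec b₁ b₂)) := by
  refine continuous_of_coordEquiv fun k => ?_
  simp only [coordEquiv_zeta]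
  fin_cases k
  · exact continuous_xi a₁ b₁
  · exact continuous_xi a₂ b₂
  · exact continuous_const
  · exact continuous_const

theorem mem_E3_iff {i₂ i₃ h : HC} : h ∈ E3 i₂ i₃ ↔ ∃ p, zeta i₂ i₃ p = h := by
  rw [E3, Submodule.mem_span_triple]
  constructor
  · rintro ⟨x, y, z, rfl⟩
    exact ⟨!₂[x, y, z], by simp [zeta]⟩
  · rintro ⟨p, rfl⟩
    exact ⟨p 0, p 1, p 2, rfl⟩

theorem mem_line_iff {a b : ℂ} {p : EuclideanSpace ℝ (Fin 3)} : p ∈ line a b ↔ xi a b p = 0 := by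
  rw [Complex.ext_iff]
  simp only [xi]
  simp
  rfl

theorem f₁_zeta (a₁ a₂ b₁ b₂ : ℂ) (p : EuclideanSpace ℝ (Fin 3)) :
    f₁ (zeta (vec a₁ a₂) (vec b₁ b₂) p) = xi a₁ b₁ p := by
  simp [f₁_apply, coordEquiv_zeta]

theorem f₂_zeta (a₁ a₂ b₁ b₂ : ℂ) (p : EuclideanSpace ℝ (Fin 3)) :
    f₂ (zeta (vec a₁ a₂) (vec b₁ b₂) p) = xi a₂ b₂ p := by
  simp [f₂_apply, coordEquiv_zeta]

theorem surjective_xiLinear {i₂ i₃ : HC} {g : HC → ℂ} {a b : ℂ}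
    (hg : g '' (E3 i₂ i₃ : Set HC) = univ) (h : ∀ p, g (zeta i₂ i₃ p) = xi a b p) :
    Function.Surjective (xiLinear a b) := by
  intro w
  obtain ⟨v, hv, rfl⟩ := hg.symm ▸ mem_univ w
  obtain ⟨p, rfl⟩ := mem_E3_iff.1 hv
  exact ⟨p, (h p).symm⟩

theorem image_domZeta {i₂ i₃ : HC} {g : HC → ℂ} {a b : ℂ}
    (h : ∀ p, g (zeta i₂ i₃ p) = xi a b p) (Ω : Set (EuclideanSpace ℝ (Fin 3))) :
    g '' domZeta i₂ i₃ Ω = xiLinear a b '' Ω := by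
  rw [domZeta, image_image]
  exact image_congr fun p _ => h p

/-- A coordinate of a right-`G`-monogenic function, in which left multiplication by `zeta p` acts
as multiplication by `xi a b p`, is an analytic function of `xi a b`. -/
theorem exists_analyticOnNhd_coord {a₁ a₂ b₁ b₂ a b : ℂ} {k : Fin 4} {g : HC → ℂ}
    (hmul : ∀ p q, coordEquiv (zeta (vec a₁ a₂) (vec b₁ b₂) p * q) k = xi a b p * coordEquiv q k)
    (hg : g '' (E3 (vec a₁ a₂) (vec b₁ b₂) : Set HC) = univ)
    (hgz : ∀ p, g (zeta (vec a₁ a₂) (vec b₁ b₂) p) = xi a b p)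
    {Ω : Set (EuclideanSpace ℝ (Fin 3))} (hΩ : IsOpen Ω) (hL : ConvexInDirection (line a b) Ω)
    {Φ : HC → HC} (hΦ : IsRightGMonogenic (E3 (vec a₁ a₂) (vec b₁ b₂))
      (domZeta (vec a₁ a₂) (vec b₁ b₂) Ω) Φ) :
    ∃ F : ℂ → ℂ, AnalyticOnNhd ℂ F (g '' domZeta (vec a₁ a₂) (vec b₁ b₂) Ω) ∧
      ∀ p ∈ Ω, coordEquiv (Φ (zeta (vec a₁ a₂) (vec b₁ b₂) p)) k = F (xi a b p) := by
  rw [image_domZeta hgz]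
  obtain ⟨hc, hder⟩ := hΦ
  choose! D hD using hder
  refine exists_analyticOnNhd_comp_linearMap (ℓ := xiLinear a b) (surjective_xiLinear hg hgz)
    (V := fun p => coordEquiv (Φ (zeta (vec a₁ a₂) (vec b₁ b₂) p)) k)
    (c := fun p => coordEquiv (D (zeta (vec a₁ a₂) (vec b₁ b₂) p)) k) hΩ ?_ ?_ ?_
  · exact (continuous_coordEquiv_apply k).comp_continuousOn
      (hc.comp (continuous_zeta _ _ _ _).continuousOn (mapsTo_image _ _))
  · intro p hp q hq hpq
    refine hL p hp q hq (mem_line_iff.2 ?_)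
    have h1 : xiLinear a b (q - p) = 0 := by rw [map_sub, hpq, sub_self]
    exact h1
  · intro p hp v
    have h1 := hD _ (mem_image_of_mem _ hp) _ (mem_E3_iff.2 ⟨v, rfl⟩)
    have h2 := ((continuous_coordEquiv_apply k).tendsto _).comp h1
    rw [hmul] at h2
    refine h2.congr fun ε => ?_
    simp only [Function.comp_apply, coordEquiv_real_smul, zeta_add_smul, map_sub, Pi.smul_apply,
      Pi.sub_apply]

end GMonogenic

open GMonogenic

theorem mainTheorem1
    (a₁ a₂ b₁ b₂ : ℂ)
    (hind : LinearIndependent ℝ ![(1 : HC), vec a₁ a₂, vec b₁ b₂])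
    (hf₁ : f₁ '' (E3 (vec a₁ a₂) (vec b₁ b₂) : Set HC) = Set.univ)
    (hf₂ : f₂ '' (E3 (vec a₁ a₂) (vec b₁ b₂) : Set HC) = Set.univ)
    (Ω : Set (EuclideanSpace ℝ (Fin 3)))
    (hΩo : IsOpen Ω) (hΩc : IsConnected Ω)
    (hL₁ : ConvexInDirection (line a₁ b₁) Ω)
    (hL₂ : ConvexInDirection (line a₂ b₂) Ω)
    (Φ : HC → HC)
    (hΦ : IsRightGMonogenic (E3 (vec a₁ a₂) (vec b₁ b₂))
      (domZeta (vec a₁ a₂) (vec b₁ b₂) Ω) Φ) :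
    ∃ F₁ F₂ F₃ F₄ : ℂ → ℂ,
      AnalyticOnNhd ℂ F₁ (f₁ '' domZeta (vec a₁ a₂) (vec b₁ b₂) Ω) ∧
      AnalyticOnNhd ℂ F₂ (f₂ '' domZeta (vec a₁ a₂) (vec b₁ b₂) Ω) ∧
      AnalyticOnNhd ℂ F₃ (f₁ '' domZeta (vec a₁ a₂) (vec b₁ b₂) Ω) ∧
      AnalyticOnNhd ℂ F₄ (f₂ '' domZeta (vec a₁ a₂) (vec b₁ b₂) Ω) ∧
      ∀ p ∈ Ω, Φ (zeta (vec a₁ a₂) (vec b₁ b₂) p) =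
        F₁ (xi a₁ b₁ p) • e₁ + F₂ (xi a₂ b₂ p) • e₂ +
          F₃ (xi a₁ b₁ p) • e₃ + F₄ (xi a₂ b₂ p) • e₄ := by
  obtain ⟨F₁, hF₁, h₁⟩ := exists_analyticOnNhd_coord (k := 0)
    (fun p q => by rw [coordEquiv_zeta_mul]; rfl) hf₁ (f₁_zeta a₁ a₂ b₁ b₂) hΩo hL₁ hΦ
  obtain ⟨F₂, hF₂, h₂⟩ := exists_analyticOnNhd_coord (k := 1)
    (fun p q => by rw [coordEquiv_zeta_mul]; rfl) hf₂ (f₂_zeta a₁ a₂ b₁ b₂) hΩo hL₂ hΦ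
  obtain ⟨F₃, hF₃, h₃⟩ := exists_analyticOnNhd_coord (k := 2)
    (fun p q => by rw [coordEquiv_zeta_mul]; rfl) hf₁ (f₁_zeta a₁ a₂ b₁ b₂) hΩo hL₁ hΦ
  obtain ⟨F₄, hF₄, h₄⟩ := exists_analyticOnNhd_coord (k := 3)
    (fun p q => by rw [coordEquiv_zeta_mul]; rfl) hf₂ (f₂_zeta a₁ a₂ b₁ b₂) hΩo hL₂ hΦ
  refine ⟨F₁, F₂, F₃, F₄, hF₁, hF₂, hF₃, hF₄, fun p hp => ?_⟩
  rw [← h₁ p hp, ← h₂ p hp, ← h₃ p hp, ← h₄ p hp]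
  -- The sum on the right is by definition `coordEquiv.symm` of the coordinates.
  exact (coordEquiv.symm_apply_apply _).symm
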